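/- Let $t\ge 5$ be odd and let $n\ge t(t-1)/2$ be an odd multiple of $(t-1)/2$. A circular design with $t$ treatments, $n$ subjects and $t$ periods assigns to subject $j$ in period $i$ a treatment $d(i,j)\in\{1,\dots,t\}$ ($1\le i\le t$, $1\le j\le n$), with the convention $d(0,j)=d(t,j)$. Let $\Lambda_{t,n,t}$ be the set of those designs in which no treatment is preceded by itself, i.e. $d(i-1,j)\ne d(i,j)$ for all $i,j$. A design is uniform on subjects if each treatment is assigned exactly once to each subject, uniform on periods if in each period all treatments occur equally often, and uniform if it is both. Let $T_d,F_d,P,U$ be the $nt\times t$, $nt\times t$, $nt\times t$, $nt\times n$ incidence matrices, with rows indexed by the pairs $(i,j)$, of the direct treatment $d(i,j)$, the preceding treatment $d(i-1,j)$, the period $i$ and the subject $j$, respectively. Put $S_d=T_d'F_d$, so that $(S_d)_{ab}$ counts the occurrences of $a$ preceded by $b$. With $\lambda=\lceil n/(t-1)\rceil$, $d$ is a circular weakly balanced design (CWBD) if all off-diagonal entries of $S_d$ belong to $\{\lambda-1,\lambda\}$, all row and column sums of $S_d$ equal $n$, and $S_dS_d'$ is completely symmetric (all diagonal entries are equal and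 all off-diagonal entries are equal). For a matrix $X$ let $\omega^\perp(X)$ be the orthogonal projector onto the orthogonal complement of the column space of $X$. Under the full model $$y_{ij}=\alpha_i+\beta_j+\tau_{d(i,j)}+\rho_{d(i-1,j)}+\varepsilon_{ij}$$ (uncorrelated errors with zero mean and common variance) the information matrices for the direct effects $\tau$ and the carry-over effects $\rho$ are $T_d'\,\omega^\perp((P:U:F_d))\,T_d$ and $F_d'\,\omega^\perp((P:U:T_d))\,F_d$. Under the model without the period effects $\alpha_i$ they are $T_d'\,\omega^\perp((U:F_d))\,T_d$ and $F_d'\,\omega^\perp((U:T_d))\,F_d$. A design $d^*\in\Lambda_{t,n,t}$ is universally optimal over $\Lambda_{t,n,t}$ (in Kiefer's sense), for given effects and a given model with information matrices $C_d$, if $\Phi(C_{d^*})\le\Phi(C_d)$ for all $d\in\Lambda_{t,n,t}$ and every function $\Phi$ from the non-negative definite $t\times t$ matrices with zero row and column sums to $(-\infty,+\infty]$ that is convex, invariant under simultaneous permutations of rows and columns, and such that $\Phi(bC)$ is nonincreasing in $b\ge 0$ for every $C$. Then: 1. every uniform CWBD $d^*\in\Lambda_{t,n,t}$ is universally optimal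 over $\Lambda_{t,n,t}$, for the estimation of direct effects as well as of carry-over effects, under the full model; 2. every CWBD $d^*\in\Lambda_{t,n,t}$ that is uniform on subjects is universally optimal over $\Lambda_{t,n,t}$, for the estimation of direct effects as well as of carry-over effects, under the model without period effects. -/

import Mathlib

open scoped Matrix

namespace RepeatedMeasurements

noncomputable section

/-- Circular designs with `t` treatments, `n` subjects and `t` periods: `d i j` is the treatment
given to subject `j` in period `i`. The treatment of the pre-period is that of the last period,
so it carries no extra data. -/
abbrev Design (t n : ℕ) : Type := Fin t → Fin n → Fin t

/-- The period before `i`; the one before the first period is the last period (the pre-period has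
the treatments of the last period). -/
def prevPeriod {t : ℕ} (i : Fin t) : Fin t := (finRotate t).symm i

/-- The class of circular designs in which no treatment is preceded by itself. -/
def Lam (t n : ℕ) : Set (Design t n) :=
  {d | ∀ i j, d (prevPeriod i) j ≠ d i j}

/-- Incidence matrix of the periods; an observation is a pair (period, subject). -/
def P (t n : ℕ) : Matrix (Fin t × Fin n) (Fin t) ℝ :=
  Matrix.of fun p i => if p.1 = i then 1 else 0

/-- Incidence matrix of the subjects. -/
def U (t n : ℕ) : Matrix (Fin t × Fin n) (Fin n) ℝ :=
  Matrix.of fun p j => if p.2 = j then 1 else 0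

/-- Design matrix of the direct effects. -/
def T {t n : ℕ} (d : Design t n) : Matrix (Fin t × Fin n) (Fin t) ℝ :=
  Matrix.of fun p a => if d p.1 p.2 = a then 1 else 0

/-- Design matrix of the carry-over effects. -/
def F {t n : ℕ} (d : Design t n) : Matrix (Fin t × Fin n) (Fin t) ℝ :=
  Matrix.of fun p a => if d (prevPeriod p.1) p.2 = a then 1 else 0

/-- The left-neighbouring matrix: entry `(a, b)` is the number of appearances of treatment `a`
preceded by treatment `b`. -/
def S {t n : ℕ} (d : Design t n) : Matrix (Fin t) (Fin t) ℝ := (T d)ᵀ * F d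

/-- In every period every treatment occurs the same number of times. -/
def UniformOnPeriods {t n : ℕ} (d : Design t n) : Prop :=
  ∃ c : ℕ, ∀ (i : Fin t) (a : Fin t), (Finset.univ.filter fun j : Fin n => d i j = a).card = c

/-- Each treatment is assigned exactly once to each subject. -/
def UniformOnSubjects {t n : ℕ} (d : Design t n) : Prop :=
  ∀ (j : Fin n) (a : Fin t), ∃! i : Fin t, d i j = a

/-- Uniform on both periods and subjects. -/
def Uniform {t n : ℕ} (d : Design t n) : Prop :=
  UniformOnPeriods d ∧ UniformOnSubjects d

/-- All diagonal entries are equal and all off-diagonal entries are equal. -/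
def CompletelySymmetric {ι : Type*} (M : Matrix ι ι ℝ) : Prop :=
  (∀ i j, M i i = M j j) ∧ ∀ i j k l, i ≠ j → k ≠ l → M i j = M k l

/-- Circular weakly balanced designs, with `⌈n / (t - 1)⌉` as the parameter `λ`. -/
structure IsCWBD {t n : ℕ} (d : Design t n) : Prop where
  pairs : ∀ a b : Fin t, a ≠ b →
    S d a b = (⌈(n : ℝ) / ((t : ℝ) - 1)⌉ : ℝ) ∨ S d a b = (⌈(n : ℝ) / ((t : ℝ) - 1)⌉ : ℝ) - 1
  row_sums : S d *ᵥ 1 = fun _ => (n : ℝ)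
  col_sums : (S d)ᵀ *ᵥ 1 = fun _ => (n : ℝ)
  symmetric : CompletelySymmetric (S d * (S d)ᵀ)

/-- The matrix of the orthogonal projector onto the orthogonal complement of the column space
of `X`, in Euclidean space. -/
def omegaPerp {m k : Type*} [Fintype m] [DecidableEq m] [Fintype k] [DecidableEq k]
    (X : Matrix m k ℝ) : Matrix m m ℝ :=
  Matrix.toEuclideanLin.symm
    ((LinearMap.range (Matrix.toEuclideanLin X))ᗮ.starProjection :
      EuclideanSpace ℝ m →ₗ[ℝ] EuclideanSpace ℝ m)

/-- Information matrix of the direct effects under the full model, with period, subject, direct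
and carry-over effects. -/
def infoDirectFull {t n : ℕ} (d : Design t n) : Matrix (Fin t) (Fin t) ℝ :=
  (T d)ᵀ * omegaPerp (Matrix.fromCols (P t n) (Matrix.fromCols (U t n) (F d))) * T d

/-- Information matrix of the carry-over effects under the full model. -/
def infoCarryFull {t n : ℕ} (d : Design t n) : Matrix (Fin t) (Fin t) ℝ :=
  (F d)ᵀ * omegaPerp (Matrix.fromCols (P t n) (Matrix.fromCols (U t n) (T d))) * F d

/-- Information matrix of the direct effects under the model without period effects. -/
def infoDirectNoPeriod {t n : ℕ} (d : Design t n) : Matrix (Fin t) (Fin t) ℝ :=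
  (T d)ᵀ * omegaPerp (Matrix.fromCols (U t n) (F d)) * T d

/-- Information matrix of the carry-over effects under the model without period effects. -/
def infoCarryNoPeriod {t n : ℕ} (d : Design t n) : Matrix (Fin t) (Fin t) ℝ :=
  (F d)ᵀ * omegaPerp (Matrix.fromCols (U t n) (T d)) * F d

/-- Non-negative definite matrices with zero row and column sums. -/
def InfoCone (t : ℕ) : Set (Matrix (Fin t) (Fin t) ℝ) :=
  {C | C.PosSemidef ∧ C *ᵥ 1 = 0 ∧ 1 ᵥ* C = 0}

/-- The optimality criteria of Kiefer's universal optimality: functionals on the non-negative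
definite matrices with zero row and column sums, with values in `(-∞, +∞]`, which are convex,
nonincreasing in `b ≥ 0` along every ray `b C`, and invariant under simultaneous permutations of
rows and columns. Values of `Φ` elsewhere are not restricted. -/
structure IsKieferCriterion {t : ℕ} (Φ : Matrix (Fin t) (Fin t) ℝ → EReal) : Prop where
  ne_bot : ∀ C ∈ InfoCone t, Φ C ≠ ⊥
  convex : ∀ C ∈ InfoCone t, ∀ D ∈ InfoCone t, ∀ a b : ℝ, 0 ≤ a → 0 ≤ b → a + b = 1 →
    Φ (a • C + b • D) ≤ (a : EReal) * Φ C + (b : EReal) * Φ D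
  antitone_ray : ∀ C ∈ InfoCone t, ∀ a b : ℝ, 0 ≤ a → a ≤ b → Φ (b • C) ≤ Φ (a • C)
  perm_invariant : ∀ C ∈ InfoCone t, ∀ σ : Equiv.Perm (Fin t), Φ (C.submatrix σ σ) = Φ C

/-- Universal optimality in Kiefer's sense: `dstar` belongs to the class `𝒟` and its information
matrix minimizes every criterion over `𝒟`. -/
def UniversallyOptimal {t n : ℕ} (info : Design t n → Matrix (Fin t) (Fin t) ℝ)
    (𝒟 : Set (Design t n)) (dstar : Design t n) : Prop :=
  dstar ∈ 𝒟 ∧ ∀ Φ : Matrix (Fin t) (Fin t) ℝ → EReal, IsKieferCriterion Φ →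
    ∀ d ∈ 𝒟, Φ (info dstar) ≤ Φ (info d)

end

end RepeatedMeasurements

/-!
By Kiefer's criterion a completely symmetric information matrix of maximal trace is universally
optimal (`IsKieferCriterion.le_of_trace_le`): averaging a competitor over all permutations of the
treatments does not increase a criterion and leads to the ray of the completely symmetric matrix.

The maximal trace is bounded for both models and both kinds of effects at once. For any `X` and `Y`
the trace of `Tᵀ * ω⊥ * T` is at most the sum of squares of the entries of `T - F * X - U * Y`
(`trace_transpose_mul_omegaPerp_mul_le`), and the optimal `Y` is explicit because `Uᵀ * U = t • 1`.
With `X = -(t - 1)⁻¹ • 1` this gives the bound for designs with all off-diagonal entries of `S` equal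
to `n / (t - 1)`, less a multiple of the sum of squares `∑ (k j a - 1) ^ 2`, where `k j a` is the
number of times subject `j` receives `a`. Here `n / (t - 1)` is half an odd integer, so each
off-diagonal entry of `S` is off by at least `1 / 2`. Adding `n⁻¹ • Wᵀ` to `X`, where `W` holds half
the signs of these deviations, lowers the bound by `t * (t - 1) / (4 * n)`. For designs that are not
uniform on subjects the lowering is disturbed by at most `(3 / n) * ∑ (k j a - 1) ^ 2`, which the
loss in the first bound absorbs as `t * (t - 1) / 2 ≤ n` and `5 ≤ t` (`exists_trace_le`).

For a CWBD that is uniform on subjects the residual of `T` is `T - n⁻¹ • F * Sᵀ`; it is orthogonal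
to `U`, and also to `P` if the design is uniform on periods. Hence in both models the information
matrix of the direct effects is `n • 1 - n⁻¹ • S * Sᵀ`, which is completely symmetric and attains
the bound since the off-diagonal entries of `S` are the two integers next to `n / (t - 1)`. Carry-over
effects exchange `T` and `F`, hence replace `S` by its transpose; `Sᵀ * S` is completely symmetric
because `S` is invertible (`CompletelySymmetric.transpose_mul_self`).
-/

namespace RepeatedMeasurements

/-! ### The residual projector -/

section Projector

variable {m k l : Type*} [Fintype m] [DecidableEq m] [Fintype k] [DecidableEq k] 

lemma omegaPerp_mulVec (X : Matrix m k ℝ) (v : m → ℝ) :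
    omegaPerp X *ᵥ v = WithLp.ofLp
      ((LinearMap.range (Matrix.toEuclideanLin X))ᗮ.starProjection (WithLp.toLp 2 v)) := by
  have h : Matrix.toEuclideanLin (omegaPerp X) (WithLp.toLp 2 v) =
      (LinearMap.range (Matrix.toEuclideanLin X))ᗮ.starProjection (WithLp.toLp 2 v) := by
    simp [omegaPerp]
  rw [← h]
  simp

lemma omegaPerp_mul_self (X : Matrix m k ℝ) : omegaPerp X * X = 0 := by
  refine Matrix.ext_of_mulVec_single fun i => ?_
  rw [← Matrix.mulVec_mulVec, omegaPerp_mulVec]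
  have h : (LinearMap.range (Matrix.toEuclideanLin X))ᗮ.starProjection
      (WithLp.toLp 2 (X *ᵥ Pi.single i 1)) = 0 := by
    rw [Submodule.starProjection_apply_eq_zero_iff]
    rw [Submodule.orthogonal_orthogonal]
    exact ⟨WithLp.toLp 2 (Pi.single i 1), rfl⟩
  rw [h, Matrix.zero_mulVec]
  rfl

lemma omegaPerp_mul_eq_self (X : Matrix m k ℝ) (M : Matrix m l ℝ) (h : Xᵀ * M = 0) :
    omegaPerp X * M = M := by
  ext i j
  have hj : omegaPerp X *ᵥ (fun i => M i j) = fun i => M i j := by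
    rw [omegaPerp_mulVec, Submodule.starProjection_eq_self_iff.2]
    rw [Submodule.mem_orthogonal]
    rintro _ ⟨w, rfl⟩
    have h0 : Xᵀ *ᵥ (fun i => M i j) = 0 := by
      ext a
      exact congrFun (congrFun h a) j
    rw [EuclideanSpace.inner_eq_star_dotProduct]
    simp only [Matrix.toLpLin_apply, star_trivial]
    rw [Matrix.dotProduct_mulVec, ← Matrix.mulVec_transpose, h0, zero_dotProduct]
  exact congrFun hj i

lemma omegaPerp_mul_omegaPerp (X : Matrix m k ℝ) : omegaPerp X * omegaPerp X = omegaPerp X := by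
  refine Matrix.ext_of_mulVec_single fun i => ?_
  rw [← Matrix.mulVec_mulVec, omegaPerp_mulVec, omegaPerp_mulVec, WithLp.toLp_ofLp]
  exact congrArg WithLp.ofLp (congrArg (· (WithLp.toLp 2 (Pi.single i (1 : ℝ))))
    (Submodule.isIdempotentElem_starProjection
      (K := (LinearMap.range (Matrix.toEuclideanLin X))ᗮ)).eq)

lemma omegaPerp_transpose (X : Matrix m k ℝ) : (omegaPerp X)ᵀ = omegaPerp X := by
  ext i j
  have h := Submodule.starProjection_isSymmetric (𝕜 := ℝ)
    (LinearMap.range (Matrix.toEuclideanLin X))ᗮ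
    (WithLp.toLp 2 (Pi.single i (1 : ℝ))) (WithLp.toLp 2 (Pi.single j (1 : ℝ)))
  have e : ∀ i j, omegaPerp X i j = (omegaPerp X *ᵥ Pi.single j 1) i := by simp
  rw [Matrix.transpose_apply, e, e, omegaPerp_mulVec, omegaPerp_mulVec]
  simpa [-Submodule.starProjection_orthogonal_val, EuclideanSpace.inner_eq_star_dotProduct]
    using h

lemma posSemidef_transpose_mul_omegaPerp_mul [Finite l] (X : Matrix m k ℝ) (M : Matrix m l ℝ) :
    (Mᵀ * omegaPerp X * M).PosSemidef := by
  have h : Mᵀ * omegaPerp X * M = (omegaPerp X * M)ᴴ * (omegaPerp X * M) := by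
    rw [Matrix.conjTranspose_eq_transpose_of_trivial, Matrix.transpose_mul, omegaPerp_transpose,
      Matrix.mul_assoc, Matrix.mul_assoc, ← Matrix.mul_assoc (omegaPerp X), omegaPerp_mul_omegaPerp]
  rw [h]
  exact Matrix.posSemidef_conjTranspose_mul_self _

/-- The residual sum of squares is at most the sum of squares of `M - X * Y`, whatever `Y`. -/
lemma trace_transpose_mul_omegaPerp_mul_le [Fintype l] (X : Matrix m k ℝ) (M : Matrix m l ℝ)
    (Y : Matrix k l ℝ) :
    (Mᵀ * omegaPerp X * M).trace ≤ ((M - X * Y)ᵀ * (M - X * Y)).trace := by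
  have h1 : omegaPerp X * (M - X * Y) = omegaPerp X * M := by
    rw [Matrix.mul_sub, ← Matrix.mul_assoc, omegaPerp_mul_self, Matrix.zero_mul, sub_zero]
  have h2 : Mᵀ * omegaPerp X * M = (M - X * Y)ᵀ * (omegaPerp X * (M - X * Y)) := by
    rw [h1, Matrix.transpose_sub, Matrix.sub_mul, Matrix.mul_assoc, Matrix.transpose_mul X Y,
      Matrix.mul_assoc Yᵀ, ← Matrix.mul_assoc Xᵀ,
      show Xᵀ * omegaPerp X = (omegaPerp X * X)ᵀ by
        rw [Matrix.transpose_mul, omegaPerp_transpose],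
      omegaPerp_mul_self, Matrix.transpose_zero, Matrix.zero_mul, Matrix.mul_zero, sub_zero]
  generalize M - X * Y = N at h2 ⊢
  have h3 : 0 ≤ ((N - omegaPerp X * N)ᴴ * (N - omegaPerp X * N)).trace :=
    (Matrix.posSemidef_conjTranspose_mul_self _).trace_nonneg
  have h4 : (N - omegaPerp X * N)ᴴ * (N - omegaPerp X * N) = Nᵀ * N - Nᵀ * (omegaPerp X * N) := by
    have h0 : omegaPerp X * (N - omegaPerp X * N) = 0 := by
      rw [Matrix.mul_sub, ← Matrix.mul_assoc, omegaPerp_mul_omegaPerp, sub_self]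
    rw [Matrix.conjTranspose_eq_transpose_of_trivial, Matrix.transpose_sub, Matrix.transpose_mul,
      omegaPerp_transpose, Matrix.sub_mul, Matrix.mul_assoc Nᵀ, h0, Matrix.mul_zero, sub_zero,
      Matrix.mul_sub]
  rw [h4, Matrix.trace_sub] at h3
  rw [h2]
  linarith

/-- If `M` differs from `M₀` by a matrix whose columns lie in the column space of `X`, and `M₀` is
orthogonal to that space, then `M₀` is the residual of `M`. -/
lemma transpose_mul_omegaPerp_mul_eq (X : Matrix m k ℝ) (M M₀ : Matrix m l ℝ) (Y : Matrix k l ℝ)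
    (hM : M = M₀ + X * Y) (h : Xᵀ * M₀ = 0) : Mᵀ * omegaPerp X * M = Mᵀ * M₀ := by
  have h1 : omegaPerp X * M = M₀ := by
    rw [hM, Matrix.mul_add, ← Matrix.mul_assoc, omegaPerp_mul_self, Matrix.zero_mul, add_zero,
      omegaPerp_mul_eq_self X M₀ h]
  rw [Matrix.mul_assoc, h1]

lemma transpose_mul_omegaPerp_mul_mem_infoCone {t : ℕ} (X : Matrix m k ℝ) (M : Matrix m (Fin t) ℝ)
    (w : k → ℝ) (h : M *ᵥ 1 = X *ᵥ w) : Mᵀ * omegaPerp X * M ∈ InfoCone t := by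
  have hpos := posSemidef_transpose_mul_omegaPerp_mul X M
  have h1 : (Mᵀ * omegaPerp X * M) *ᵥ 1 = 0 := by
    rw [← Matrix.mulVec_mulVec, h, Matrix.mulVec_mulVec, Matrix.mul_assoc, omegaPerp_mul_self,
      Matrix.mul_zero, Matrix.zero_mulVec]
  refine ⟨hpos, h1, ?_⟩
  rw [← Matrix.mulVec_transpose, ← Matrix.conjTranspose_eq_transpose_of_trivial, hpos.1, h1]

end Projector

/-! ### Kiefer criteria and completely symmetric matrices -/

lemma convex_infoCone (t : ℕ) : Convex ℝ (InfoCone t) := by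
  rintro C ⟨hC, hC1, hC2⟩ D ⟨hD, hD1, hD2⟩ a b ha hb -
  refine ⟨(hC.smul ha).add (hD.smul hb), ?_, ?_⟩
  · rw [Matrix.add_mulVec, Matrix.smul_mulVec, Matrix.smul_mulVec, hC1, hD1]; simp
  · rw [Matrix.vecMul_add, Matrix.vecMul_smul, Matrix.vecMul_smul, hC2, hD2]; simp

lemma submatrix_perm_mem_infoCone {t : ℕ} {C : Matrix (Fin t) (Fin t) ℝ} (hC : C ∈ InfoCone t)
    (σ : Equiv.Perm (Fin t)) : C.submatrix σ σ ∈ InfoCone t := by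
  obtain ⟨h, h1, h2⟩ := hC
  refine ⟨h.submatrix σ, ?_, ?_⟩
  · ext i
    have := congrFun h1 (σ i)
    simp only [Matrix.mulVec, dotProduct, Pi.one_apply, mul_one, Pi.zero_apply,
      Matrix.submatrix_apply] at this ⊢
    rw [← this]
    exact Equiv.sum_comp σ fun j => C (σ i) j
  · ext i
    have := congrFun h2 (σ i)
    simp only [Matrix.vecMul, dotProduct, Pi.one_apply, one_mul, Pi.zero_apply,
      Matrix.submatrix_apply] at this ⊢
    rw [← this]
    exact Equiv.sum_comp σ fun j => C j (σ i)

lemma IsKieferCriterion.convex_sublevel {t : ℕ} {Φ : Matrix (Fin t) (Fin t) ℝ → EReal}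
    (hΦ : IsKieferCriterion Φ) (v : ℝ) : Convex ℝ {C | C ∈ InfoCone t ∧ Φ C ≤ v} := by
  rintro C ⟨hC, hCv⟩ D ⟨hD, hDv⟩ a b ha hb hab
  refine ⟨convex_infoCone t hC hD ha hb hab, (hΦ.convex C hC D hD a b ha hb hab).trans ?_⟩
  have h1 : (a : EReal) * Φ C ≤ a * v := mul_le_mul_of_nonneg_left hCv (by exact_mod_cast ha)
  have h2 : (b : EReal) * Φ D ≤ b * v := mul_le_mul_of_nonneg_left hDv (by exact_mod_cast hb)
  refine (add_le_add h1 h2).trans_eq ?_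
  rw [← EReal.coe_mul, ← EReal.coe_mul, ← EReal.coe_add, ← add_mul, hab, one_mul]

/-- The average of a matrix over all simultaneous permutations of its rows and columns. -/
noncomputable def permAverage {t : ℕ} (C : Matrix (Fin t) (Fin t) ℝ) : Matrix (Fin t) (Fin t) ℝ :=
  ∑ σ : Equiv.Perm (Fin t), (Fintype.card (Equiv.Perm (Fin t)) : ℝ)⁻¹ • C.submatrix σ σ

lemma permAverage_mem {t : ℕ} {C : Matrix (Fin t) (Fin t) ℝ}
    {s : Set (Matrix (Fin t) (Fin t) ℝ)} (hs : Convex ℝ s)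
    (h : ∀ σ : Equiv.Perm (Fin t), C.submatrix σ σ ∈ s) : permAverage C ∈ s := by
  refine hs.sum_mem (fun _ _ => by positivity) ?_ fun σ _ => h σ
  rw [Finset.sum_const, nsmul_eq_mul, Finset.card_univ]
  exact mul_inv_cancel₀ (Nat.cast_ne_zero.2 Fintype.card_ne_zero)

lemma IsKieferCriterion.permAverage_le {t : ℕ} {Φ : Matrix (Fin t) (Fin t) ℝ → EReal}
    (hΦ : IsKieferCriterion Φ) {C : Matrix (Fin t) (Fin t) ℝ} (hC : C ∈ InfoCone t) :
    Φ (permAverage C) ≤ Φ C := by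
  by_cases htop : Φ C = ⊤
  · rw [htop]; exact le_top
  have hv : ((Φ C).toReal : EReal) = Φ C := EReal.coe_toReal htop (hΦ.ne_bot C hC)
  have := permAverage_mem (C := C) (hΦ.convex_sublevel (Φ C).toReal) fun σ =>
    ⟨submatrix_perm_mem_infoCone hC σ, by rw [hΦ.perm_invariant C hC σ, hv]⟩
  rw [← hv]
  exact this.2

lemma permAverage_trace {t : ℕ} (C : Matrix (Fin t) (Fin t) ℝ) :
    (permAverage C).trace = C.trace := by
  have h : ∀ σ : Equiv.Perm (Fin t), (C.submatrix σ σ).trace = C.trace := fun σ =>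
    Equiv.sum_comp σ fun i => C i i
  rw [permAverage, Matrix.trace_sum]
  simp only [Matrix.trace_smul, h, Finset.sum_const, nsmul_eq_mul, Finset.card_univ, smul_eq_mul]
  exact mul_inv_cancel_left₀ (Nat.cast_ne_zero.2 Fintype.card_ne_zero) _

lemma permAverage_apply_perm {t : ℕ} (C : Matrix (Fin t) (Fin t) ℝ) (τ : Equiv.Perm (Fin t))
    (i j : Fin t) : permAverage C (τ i) (τ j) = permAverage C i j := by
  simp only [permAverage, Matrix.sum_apply, Matrix.smul_apply, Matrix.submatrix_apply]
  exact Equiv.sum_comp (Equiv.mulRight τ)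
    fun σ => (Fintype.card (Equiv.Perm (Fin t)) : ℝ)⁻¹ • C (σ i) (σ j)

lemma completelySymmetric_permAverage {t : ℕ} (C : Matrix (Fin t) (Fin t) ℝ) :
    CompletelySymmetric (permAverage C) := by
  refine ⟨fun i j => ?_, fun i j k l hij hkl => ?_⟩
  · simpa using (permAverage_apply_perm C (Equiv.swap i j) i i).symm
  · -- the symmetric group acts doubly transitively
    have hne : k ≠ Equiv.swap i k j := by
      intro h
      exact hij ((Equiv.swap i k).injective (by rw [Equiv.swap_apply_left, ← h]))
    have h := permAverage_apply_perm C (Equiv.swap (Equiv.swap i k j) l * Equiv.swap i k) i j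
    rw [Equiv.Perm.mul_apply, Equiv.Perm.mul_apply, Equiv.swap_apply_left,
      Equiv.swap_apply_left, Equiv.swap_apply_of_ne_of_ne hne hkl] at h
    exact h.symm

lemma CompletelySymmetric.trace_eq {t : ℕ} {C : Matrix (Fin t) (Fin t) ℝ}
    (hC : CompletelySymmetric C) (i : Fin t) : C.trace = t * C i i := by
  simp [Matrix.trace, fun j => hC.1 j i]

lemma CompletelySymmetric.diag_add {t : ℕ} {C : Matrix (Fin t) (Fin t) ℝ}
    (hC : CompletelySymmetric C) (hC1 : C *ᵥ 1 = 0) {i j : Fin t} (hij : i ≠ j) :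
    C i i + ((t : ℝ) - 1) * C i j = 0 := by
  have h := congrFun hC1 i
  simp only [Matrix.mulVec, dotProduct, Pi.one_apply, mul_one, Pi.zero_apply] at h
  rw [← Finset.add_sum_erase _ _ (Finset.mem_univ i),
    Finset.sum_congr rfl fun k hk => hC.2 i k i j (Finset.ne_of_mem_erase hk).symm hij,
    Finset.sum_const, Finset.card_erase_of_mem (Finset.mem_univ i), Finset.card_univ,
    Fintype.card_fin, nsmul_eq_mul, Nat.cast_pred i.pos] at h
  exact h

lemma CompletelySymmetric.ext_of_trace_eq {t : ℕ} {C D : Matrix (Fin t) (Fin t) ℝ}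
    (hC : CompletelySymmetric C) (hD : CompletelySymmetric D) (hC1 : C *ᵥ 1 = 0)
    (hD1 : D *ᵥ 1 = 0) (h : C.trace = D.trace) : C = D := by
  have hdiag : ∀ i, C i i = D i i := fun i => by
    rw [hC.trace_eq i, hD.trace_eq i] at h
    exact mul_left_cancel₀ (Nat.cast_ne_zero.2 i.pos.ne') h
  ext i j
  obtain rfl | hij := eq_or_ne i j
  · exact hdiag i
  have ht : (t : ℝ) - 1 ≠ 0 := by
    have : 1 < t := by have := i.isLt; have := j.isLt; have := Fin.val_ne_of_ne hij; omega
    have : (1 : ℝ) < t := by exact_mod_cast this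
    linarith
  have h1 := hC.diag_add hC1 hij
  have h2 := hD.diag_add hD1 hij
  refine mul_left_cancel₀ ht ?_
  linarith [hdiag i]

lemma CompletelySymmetric.smul {ι : Type*} {C : Matrix ι ι ℝ} (hC : CompletelySymmetric C)
    (b : ℝ) : CompletelySymmetric (b • C) :=
  ⟨fun i j => by simp [hC.1 i j], fun i j k l h h' => by simp [hC.2 i j k l h h']⟩

/-- Kiefer's sufficient condition for universal optimality: a completely symmetric information
matrix of maximal trace minimizes every criterion. -/
lemma IsKieferCriterion.le_of_trace_le {t : ℕ} {Φ : Matrix (Fin t) (Fin t) ℝ → EReal}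
    (hΦ : IsKieferCriterion Φ) {C D : Matrix (Fin t) (Fin t) ℝ} (hC : C ∈ InfoCone t)
    (hD : D ∈ InfoCone t) (hCs : CompletelySymmetric C) (h : D.trace ≤ C.trace) :
    Φ C ≤ Φ D := by
  refine le_trans ?_ (hΦ.permAverage_le hD)
  have hA : permAverage D ∈ InfoCone t :=
    permAverage_mem (convex_infoCone t) (submatrix_perm_mem_infoCone hD)
  have hD0 : 0 ≤ D.trace := hD.1.trace_nonneg
  -- `permAverage D` is the completely symmetric matrix on the ray of `C` with the trace of `D`
  have hAeq : permAverage D = (D.trace / C.trace) • C := by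
    refine (completelySymmetric_permAverage D).ext_of_trace_eq (hCs.smul _) hA.2.1 ?_ ?_
    · rw [Matrix.smul_mulVec, hC.2.1, smul_zero]
    · rw [permAverage_trace, Matrix.trace_smul, smul_eq_mul]
      obtain h0 | h0 := eq_or_ne C.trace 0
      · rw [h0, mul_zero]; linarith
      · exact (div_mul_cancel₀ _ h0).symm
  have := hΦ.antitone_ray C hC (D.trace / C.trace) 1 (div_nonneg hD0 (hD0.trans h))
    (div_le_one_of_le₀ h (hD0.trans h))
  rwa [one_smul, ← hAeq] at this

/-! ### The upper bound for the trace -/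

section TraceBound

variable {o : Type*} [Fintype o]

/-- The sum of squares left after projecting off `U`, when `Uᵀ * U` is scalar. -/
lemma transpose_mul_self_sub_smul {ι κ : Type*} [Fintype κ] [DecidableEq κ]
    (U : Matrix o κ ℝ) (V : Matrix o ι ℝ) {c : ℝ} (hc : c ≠ 0) (hU : Uᵀ * U = c • 1) :
    (V - U * (c⁻¹ • (Uᵀ * V)))ᵀ * (V - U * (c⁻¹ • (Uᵀ * V))) =
      Vᵀ * V - c⁻¹ • ((Uᵀ * V)ᵀ * (Uᵀ * V)) := by
  have h0 : Uᵀ * (V - U * (c⁻¹ • (Uᵀ * V))) = 0 := by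
    rw [Matrix.mul_sub, ← Matrix.mul_assoc, hU, Matrix.smul_mul, Matrix.one_mul,
      smul_inv_smul₀ hc, sub_self]
  rw [Matrix.transpose_sub, Matrix.sub_mul, Matrix.transpose_mul U, Matrix.mul_assoc _ Uᵀ, h0,
    Matrix.mul_zero, sub_zero, Matrix.mul_sub, ← Matrix.mul_assoc, Matrix.mul_smul,
    Matrix.transpose_mul Uᵀ, Matrix.transpose_transpose]

/-- An integer is at most its square in modulus, so the linear terms of `p * q - 1` in `p - 1` and
`q - 1` are bounded by squares as well. -/
lemma abs_natCast_mul_sub_one_le (p q : ℕ) :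
    |(p : ℝ) * q - 1| ≤ 3 / 2 * (((p : ℝ) - 1) ^ 2 + ((q : ℝ) - 1) ^ 2) := by
  have key : ∀ p : ℕ, |(p : ℝ) - 1| ≤ ((p : ℝ) - 1) ^ 2 := fun p => by
    have h : |(p : ℤ) - 1| ≤ ((p : ℤ) - 1) ^ 2 := by
      rw [← sq_abs]
      exact Int.le_self_sq _
    exact_mod_cast h
  have hp := key p
  have hq := key q
  rw [abs_le] at hp hq ⊢
  constructor <;> nlinarith [sq_nonneg ((p : ℝ) - 1 + (q - 1)), sq_nonneg ((p : ℝ) - 1 - (q - 1))]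

lemma sum_sum_ite_eq_zero_else {t : ℕ} (c : ℝ) :
    ∑ a : Fin t, ∑ b : Fin t, (if a = b then 0 else c) = t * (t - 1) * c := by
  have h : ∀ a : Fin t, ∑ b : Fin t, (if a = b then 0 else c) = (t - 1) * c := fun a => by
    have h1 : ∀ b : Fin t, (if a = b then 0 else c) = c - (if a = b then c else 0) := fun b => by
      split_ifs <;> ring
    simp only [h1, Finset.sum_sub_distrib, Finset.sum_ite_eq, Finset.mem_univ, if_true,
      Finset.sum_const, Finset.card_univ, Fintype.card_fin, nsmul_eq_mul]
    ring
  simp [h]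
  ring

/-- The cross products of the replication numbers `k` of one subject, weighted by `W`, exceed those
of a subject receiving every treatment once by at most a multiple of `∑ a, (k a - 1) ^ 2`. -/
lemma sum_mul_weight_le {t : ℕ} (k : Fin t → ℕ) (W : Fin t → Fin t → ℝ) (hW0 : ∀ a, W a a = 0)
    (hW : ∀ a b, |W a b| ≤ 1 / 2) :
    ∑ a, ∑ b, (k a : ℝ) * k b * W a b ≤
      ∑ a, ∑ b, W a b + 3 / 2 * (t - 1) * ∑ a, ((k a : ℝ) - 1) ^ 2 := by
  have h1 : ∀ a b, (k a : ℝ) * k b * W a b - W a b ≤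
      3 / 4 * (((k a : ℝ) - 1) ^ 2 + ((k b : ℝ) - 1) ^ 2) -
        if a = b then 3 / 2 * ((k a : ℝ) - 1) ^ 2 else 0 := by
    intro a b
    split_ifs with h
    · subst h
      rw [hW0]
      apply le_of_eq
      ring
    · calc (k a : ℝ) * k b * W a b - W a b = ((k a : ℝ) * k b - 1) * W a b := by ring
        _ ≤ |(k a : ℝ) * k b - 1| * |W a b| := by rw [← abs_mul]; exact le_abs_self _
        _ ≤ 3 / 2 * (((k a : ℝ) - 1) ^ 2 + ((k b : ℝ) - 1) ^ 2) * (1 / 2) :=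
          mul_le_mul (abs_natCast_mul_sub_one_le _ _) (hW a b) (abs_nonneg _) (by positivity)
        _ = _ := by ring
  have h2 := Finset.sum_le_sum fun a (_ : a ∈ Finset.univ) =>
    Finset.sum_le_sum fun b (_ : b ∈ Finset.univ) => h1 a b
  simp only [Finset.sum_sub_distrib, Finset.sum_add_distrib, ← Finset.mul_sum, Finset.sum_ite_eq,
    Finset.mem_univ, if_true, Finset.sum_const, Finset.card_univ, Fintype.card_fin,
    nsmul_eq_mul] at h2
  linarith

/-- Half the sign of `s a b - m / 2` off the diagonal, and `0` on it. -/
noncomputable def signWeight {t : ℕ} (m : ℕ) (s : Fin t → Fin t → ℕ) (a b : Fin t) : ℝ :=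
  if a = b then 0 else if m < 2 * s a b then 1 / 2 else -(1 / 2)

lemma signWeight_self {t : ℕ} (m : ℕ) (s : Fin t → Fin t → ℕ) (a : Fin t) :
    signWeight m s a a = 0 := if_pos rfl

lemma signWeight_sq {t : ℕ} (m : ℕ) (s : Fin t → Fin t → ℕ) (a b : Fin t) :
    signWeight m s a b ^ 2 = if a = b then 0 else 1 / 4 := by
  unfold signWeight
  split_ifs <;> norm_num

lemma abs_signWeight_le {t : ℕ} (m : ℕ) (s : Fin t → Fin t → ℕ) (a b : Fin t) :
    |signWeight m s a b| ≤ 1 / 2 := by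
  unfold signWeight
  split_ifs <;> norm_num [abs_of_pos]

/-- As `m` is odd, `s a b` differs from `m / 2` by at least `1 / 2`. -/
lemma le_mul_signWeight {t m : ℕ} (hm : Odd m) (s : Fin t → Fin t → ℕ) (a b : Fin t) :
    (if a = b then 0 else 1 / 4 : ℝ) ≤ ((s a b : ℝ) - m / 2) * signWeight m s a b := by
  unfold signWeight
  split_ifs with h h'
  · simp
  · have : (m : ℝ) + 1 ≤ 2 * s a b := by exact_mod_cast h'
    linarith
  · have h2 : 2 * s a b + 1 ≤ m := by obtain ⟨l, rfl⟩ := hm; omega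
    have : 2 * (s a b : ℝ) + 1 ≤ m := by exact_mod_cast h2
    linarith

/-- The trace bound. The fitted part combines the multiple `-1 / (t - 1)` of the identity, which is
optimal for equal off-diagonal entries of `S`, with a correction by the signs of the deviations of
these entries from `n / (t - 1)`, which are at least `1 / 2` in modulus. A subject that does not
receive every treatment once weakens the correction by no more than it loses in the main term. -/
lemma exists_trace_le {t n m : ℕ} (ht : 5 ≤ t) (hm : Odd m) (hnm : (2 * n : ℝ) = m * (t - 1))
    (hn : (t * (t - 1) : ℝ) ≤ 2 * n)
    (T F : Matrix o (Fin t) ℝ) (U : Matrix o (Fin n) ℝ) (k : Fin n → Fin t → ℕ)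
    (s : Fin t → Fin t → ℕ) (hTT : Tᵀ * T = Matrix.diagonal fun a => ∑ j, (k j a : ℝ))
    (hFF : Fᵀ * F = Matrix.diagonal fun a => ∑ j, (k j a : ℝ))
    (hUT : Uᵀ * T = Matrix.of fun j a => (k j a : ℝ))
    (hUF : Uᵀ * F = Matrix.of fun j a => (k j a : ℝ)) (hUU : Uᵀ * U = (t : ℝ) • 1)
    (hTF : Tᵀ * F = Matrix.of fun a b => (s a b : ℝ)) (hk : ∀ j, ∑ a, k j a = t)
    (hs : ∀ a, s a a = 0) :
    ∃ (X : Matrix (Fin t) (Fin t) ℝ) (Y : Matrix (Fin n) (Fin t) ℝ),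
      ((T - F * X - U * Y)ᵀ * (T - F * X - U * Y)).trace ≤
        n * t - t * n / (t - 1) - t * (t - 1) / (4 * n) := by
  set W := signWeight m s with hWdef
  have ht' : (5 : ℝ) ≤ t := by exact_mod_cast ht
  have htpos : (0 : ℝ) < (t : ℝ) - 1 := by linarith
  have hnpos : (0 : ℝ) < n := by nlinarith
  set x : ℝ := -1 / (t - 1) with hx
  set X : Matrix (Fin t) (Fin t) ℝ := Matrix.of fun b a => (if b = a then x else 0) + W a b / n
    with hX
  refine ⟨X, (t : ℝ)⁻¹ • (Uᵀ * (T - F * X)), ?_⟩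
  rw [transpose_mul_self_sub_smul U (T - F * X) (by positivity) hUU, Matrix.trace_sub,
    Matrix.trace_smul, smul_eq_mul]
  set δ : Fin n → ℝ := fun j => ∑ a, ((k j a : ℝ) - 1) ^ 2 with hδ
  have hδ0 : ∀ j, 0 ≤ δ j := fun j => Finset.sum_nonneg fun a _ => sq_nonneg _
  have hkR : ∀ j, ∑ a, (k j a : ℝ) = t := fun j => by exact_mod_cast hk j
  have hk2 : ∀ j, ∑ a, (k j a : ℝ) ^ 2 = t + δ j := fun j => by
    have : ∀ a, (k j a : ℝ) ^ 2 = ((k j a : ℝ) - 1) ^ 2 + 2 * k j a - 1 := fun a => by ring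
    simp only [this, Finset.sum_sub_distrib, Finset.sum_add_distrib, ← Finset.mul_sum, hkR,
      Finset.sum_const, Finset.card_univ, Fintype.card_fin, nsmul_eq_mul, hδ]
    ring
  have hr : ∑ a, ∑ j, (k j a : ℝ) = n * t := by
    rw [Finset.sum_comm]
    simp [hkR]
  -- the sum of squares of `T - F * X`
  have hV : ((T - F * X)ᵀ * (T - F * X)).trace =
      n * t - 2 / n * (∑ a, ∑ b, (s a b : ℝ) * W a b) + x ^ 2 * (n * t) +
        t * (t - 1) / (4 * n) := by
    have e1 : (T - F * X)ᵀ * (T - F * X) = Tᵀ * T - Tᵀ * F * X - (Tᵀ * F * X)ᵀ +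
        Xᵀ * (Fᵀ * F) * X := by
      simp only [Matrix.transpose_sub, Matrix.transpose_mul, Matrix.sub_mul, Matrix.mul_sub,
        Matrix.mul_assoc, Matrix.transpose_transpose]
      abel
    have e2 : (Tᵀ * F * X).trace = 1 / n * ∑ a, ∑ b, (s a b : ℝ) * W a b := by
      rw [hTF]
      simp only [Matrix.trace, Matrix.diag_apply, Matrix.mul_apply, Matrix.of_apply, hX, mul_add,
        Finset.sum_add_distrib, mul_ite, mul_zero, Finset.sum_ite_eq', Finset.mem_univ, if_true,
        hs, Finset.mul_sum]
      simp only [Nat.cast_zero, zero_mul, Finset.sum_const_zero, zero_add]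
      refine Finset.sum_congr rfl fun a _ => Finset.sum_congr rfl fun b _ => ?_
      ring
    have e3 : (Xᵀ * (Fᵀ * F) * X).trace = x ^ 2 * (n * t) + t * (t - 1) / (4 * n) := by
      have e4 : ∀ a b, Xᵀ a b * (∑ j, (k j b : ℝ)) * X b a =
          (if b = a then x ^ 2 * ∑ j, (k j b : ℝ) else 0) +
            1 / n ^ 2 * ((∑ j, (k j b : ℝ)) * if b = a then 0 else 1 / 4) := by
        intro a b
        have := signWeight_sq m s a b
        simp only [Matrix.transpose_apply, hX, Matrix.of_apply]
        split_ifs with h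
        · subst h
          rw [hWdef, signWeight_self]
          ring
        · rw [if_neg (Ne.symm h)] at this
          rw [← this]
          field_simp
          ring
      have e5 : ∀ b : Fin t, ∑ a, (if b = a then (0 : ℝ) else 1 / 4) = (t - 1) / 4 := by
        intro b
        have : ∀ a, (if b = a then (0 : ℝ) else 1 / 4) = 1 / 4 - if b = a then 1 / 4 else 0 :=
          fun a => by split_ifs <;> ring
        simp only [this, Finset.sum_sub_distrib, Finset.sum_ite_eq, Finset.mem_univ, if_true,
          Finset.sum_const, Finset.card_univ, Fintype.card_fin, nsmul_eq_mul]
        ring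
      rw [hFF]
      simp only [Matrix.trace, Matrix.diag_apply, Matrix.mul_apply (M := Xᵀ * _),
        Matrix.mul_diagonal, e4]
      rw [Finset.sum_comm]
      simp only [Finset.sum_add_distrib, Finset.sum_ite_eq, Finset.mem_univ, if_true,
        ← Finset.mul_sum, e5]
      rw [← Finset.sum_mul, hr]
      field_simp
    have e6 : (Tᵀ * T).trace = n * t := by
      rw [hTT, Matrix.trace_diagonal, hr]
    rw [e1, Matrix.trace_add, Matrix.trace_sub, Matrix.trace_sub, Matrix.trace_transpose, e2, e3,
      e6]
    ring
  -- the part of it that lies in the column space of `U`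
  have hUV : (1 - x) ^ 2 * (n * t + ∑ j, δ j) - 2 * (1 - x) / n *
      (n * (∑ a, ∑ b, W a b) + 3 / 2 * (t - 1) * ∑ j, δ j) ≤
        ((Uᵀ * (T - F * X))ᵀ * (Uᵀ * (T - F * X))).trace := by
    have e1 : ∀ j a, (Uᵀ * (T - F * X)) j a =
        (1 - x) * k j a - 1 / n * ∑ b, (k j b : ℝ) * W a b := by
      intro j a
      rw [Matrix.mul_sub, ← Matrix.mul_assoc, hUT, hUF]
      simp only [Matrix.sub_apply, Matrix.mul_apply, Matrix.of_apply, hX, mul_add,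
        Finset.sum_add_distrib, mul_ite, mul_zero, Finset.sum_ite_eq', Finset.mem_univ, if_true,
        Finset.mul_sum]
      rw [Finset.sum_congr rfl fun b _ =>
        show (k j b : ℝ) * (W a b / n) = 1 / n * (k j b * W a b) by ring]
      ring
    have e2 : ∀ j, (1 - x) ^ 2 * (t + δ j) - 2 * (1 - x) / n *
        (∑ a, ∑ b, W a b + 3 / 2 * (t - 1) * δ j) ≤ ∑ a, (Uᵀ * (T - F * X)) j a ^ 2 := by
      intro j
      have e3 : ∀ a, (1 - x) ^ 2 * (k j a : ℝ) ^ 2 - 2 * (1 - x) / n *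
          ∑ b, (k j a : ℝ) * k j b * W a b ≤ (Uᵀ * (T - F * X)) j a ^ 2 := by
        intro a
        rw [e1]
        simp only [mul_assoc, ← Finset.mul_sum]
        have : 0 ≤ (1 / n * ∑ b, (k j b : ℝ) * W a b) ^ 2 := sq_nonneg _
        calc _ ≤ _ := le_add_of_nonneg_right this
          _ = _ := by ring
      have e4 := Finset.sum_le_sum fun a (_ : a ∈ Finset.univ) => e3 a
      rw [Finset.sum_sub_distrib, ← Finset.mul_sum, ← Finset.mul_sum, hk2] at e4
      refine le_trans ?_ e4
      have hx1 : 0 ≤ 2 * (1 - x) / n := by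
        have : x ≤ 0 := by rw [hx]; exact div_nonpos_of_nonpos_of_nonneg (by norm_num) htpos.le
        exact div_nonneg (by linarith) hnpos.le
      exact sub_le_sub_left (mul_le_mul_of_nonneg_left
        (sum_mul_weight_le (k j) W (signWeight_self m s) (abs_signWeight_le m s)) hx1) _
    have e5 := Finset.sum_le_sum fun j (_ : j ∈ Finset.univ) => e2 j
    simp only [Finset.sum_sub_distrib, ← Finset.mul_sum, Finset.sum_add_distrib, Finset.sum_const,
      Finset.card_univ, Fintype.card_fin, nsmul_eq_mul] at e5
    refine e5.trans_eq ?_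
    rw [Finset.sum_comm]
    simp only [Matrix.trace, Matrix.diag_apply, Matrix.mul_apply (M := (Uᵀ * (T - F * X))ᵀ),
      Matrix.transpose_apply, sq]
  -- the gain from the integrality of `S`
  have hS : t * (t - 1) / 4 ≤ (∑ a, ∑ b, (s a b : ℝ) * W a b) - m / 2 * ∑ a, ∑ b, W a b := by
    have := Finset.sum_le_sum fun a (_ : a ∈ Finset.univ) =>
      Finset.sum_le_sum fun b (_ : b ∈ Finset.univ) => le_mul_signWeight hm s a b
    rw [sum_sum_ite_eq_zero_else] at this
    simp only [sub_mul, Finset.sum_sub_distrib, ← Finset.mul_sum] at this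
    linarith
  rw [hV]
  have hΔ : 0 ≤ ∑ j, δ j := Finset.sum_nonneg fun j _ => hδ0 j
  generalize ∑ j, δ j = Δ at hUV hΔ
  generalize ∑ a, ∑ b, W a b = w at hUV hS
  generalize ∑ a, ∑ b, (s a b : ℝ) * W a b = sw at hS ⊢
  generalize ((Uᵀ * (T - F * X))ᵀ * (Uᵀ * (T - F * X))).trace = q at hUV ⊢
  set u : ℝ := (t : ℝ) - 1 with hu
  have hq : t ^ 2 * n / u ^ 2 + t * Δ / u ^ 2 - 2 * w / u - 3 * Δ / n ≤ (t : ℝ)⁻¹ * q := by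
    have h1x : 1 - x = t / u := by
      rw [hx]
      field_simp
      rw [hu]
      ring
    rw [h1x] at hUV
    refine le_trans (le_of_eq ?_)
      (mul_le_mul_of_nonneg_left hUV (inv_nonneg.2 (by positivity : (0 : ℝ) ≤ t)))
    field_simp
    ring
  have hsw : t * u / (2 * n) + 2 * w / u ≤ 2 / n * sw := by
    have hm2 : (m : ℝ) / 2 = n / u := by
      field_simp
      linarith
    rw [hm2] at hS
    refine le_trans (le_of_eq ?_) (mul_le_mul_of_nonneg_left
      (sub_nonneg.1 (by linarith) : t * u / 4 + n / u * w ≤ sw) (by positivity : 0 ≤ 2 / (n : ℝ)))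
    field_simp
    ring
  -- this is where `t * (t - 1) / 2 ≤ n` and `5 ≤ t` enter
  have hloss : 3 * Δ / n ≤ t * Δ / u ^ 2 := by
    rw [div_le_div_iff₀ hnpos (by positivity)]
    have h2 : 3 * u ^ 2 ≤ t * n := by nlinarith
    nlinarith
  have hfinal : x ^ 2 * (n * t) - t ^ 2 * n / u ^ 2 = -(t * n / u) := by
    rw [hx]
    field_simp
    rw [hu]
    ring
  have hhalf : t * u / (4 * n) - t * u / (2 * n) = -(t * u / (4 * n)) := by ring
  linarith

end TraceBound

/-! ### Information matrices of balanced designs -/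

/-- A matrix with constant row and column sums, zero diagonal and nonzero entries elsewhere has
distinct rows, so complete symmetry of `S * Sᵀ` makes `S` invertible; then
`Sᵀ * S = S⁻¹ * (S * Sᵀ) * S` is the same completely symmetric matrix. -/
lemma CompletelySymmetric.transpose_mul_self {t : ℕ} (ht : 2 ≤ t) {S : Matrix (Fin t) (Fin t) ℝ}
    {c : ℝ} (hc : 0 < c) (hS : CompletelySymmetric (S * Sᵀ)) (hrow : S *ᵥ 1 = fun _ => c)
    (hcol : Sᵀ *ᵥ 1 = fun _ => c) (hdiag : ∀ a, S a a = 0) (hoff : ∀ a b, a ≠ b → S a b ≠ 0) :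
    CompletelySymmetric (Sᵀ * S) := by
  set J : Matrix (Fin t) (Fin t) ℝ := Matrix.of fun _ _ => 1 with hJ
  have hSJ : S * J = c • J := by
    ext i j
    simpa [Matrix.mul_apply, Matrix.mulVec, dotProduct, hJ] using congrFun hrow i
  have hJS : J * S = c • J := by
    ext i j
    simpa [Matrix.mul_apply, Matrix.mulVec, dotProduct, hJ] using congrFun hcol j
  have hJSt : J * Sᵀ = c • J := by
    have := congrArg Matrix.transpose hSJ
    rwa [Matrix.transpose_mul, Matrix.transpose_smul, show Jᵀ = J from rfl] at this
  have hJJ : J * J = (t : ℝ) • J := by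
    ext i j
    simp [Matrix.mul_apply, hJ]
  let p : Fin t := ⟨0, by omega⟩
  let q : Fin t := ⟨1, by omega⟩
  have hpq : p ≠ q := by simp [p, q, Fin.ext_iff]
  set β := (S * Sᵀ) p q with hβ
  set α := (S * Sᵀ) p p - β with hα
  have hSS : S * Sᵀ = α • 1 + β • J := by
    ext i j
    obtain rfl | hij := eq_or_ne i j
    · simp [hJ, hα, hS.1 i p]
    · simp [hJ, hij, hS.2 i j p q hij hpq, hβ]
  -- `2 * α` is the squared distance of two rows of `S`
  have hα0 : 0 < α := by
    have h1 : 2 * α = ∑ b, (S p b - S q b) ^ 2 := by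
      have h2 : (S * Sᵀ) q q = (S * Sᵀ) p p := hS.1 q p
      have h3 : 2 * α = (S * Sᵀ) p p + (S * Sᵀ) q q - 2 * (S * Sᵀ) p q := by rw [h2, hα, hβ]; ring
      rw [h3]
      simp only [Matrix.mul_apply, Matrix.transpose_apply, Finset.mul_sum, ←
        Finset.sum_add_distrib, ← Finset.sum_sub_distrib]
      exact Finset.sum_congr rfl fun b _ => by ring
    have h4 : 0 < ∑ b, (S p b - S q b) ^ 2 := by
      refine Finset.sum_pos' (fun b _ => sq_nonneg _) ⟨q, Finset.mem_univ _, ?_⟩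
      rw [hdiag, sub_zero]
      have := hoff p q hpq
      positivity
    linarith
  have hsum : (α + t * β) • J = c ^ 2 • J := by
    have h1 : J * (S * Sᵀ) = c ^ 2 • J := by
      rw [← Matrix.mul_assoc, hJS, Matrix.smul_mul, hJSt, smul_smul, sq]
    rw [← h1, hSS, Matrix.mul_add, Matrix.mul_smul, Matrix.mul_smul, hJJ, Matrix.mul_one, smul_smul,
      ← add_smul, mul_comm β]
  have hαβ : α + t * β = c ^ 2 := by simpa [hJ] using congrFun (congrFun hsum p) p
  have hright : S * (Sᵀ * (α⁻¹ • (1 - (β / c ^ 2) • J))) = 1 := by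
    rw [← Matrix.mul_assoc, hSS, Matrix.mul_smul, Matrix.mul_sub, Matrix.mul_one, Matrix.mul_smul,
      Matrix.add_mul, Matrix.smul_mul, Matrix.smul_mul, hJJ, Matrix.one_mul]
    ext i j
    simp only [Matrix.smul_apply, Matrix.sub_apply, Matrix.add_apply, hJ, Matrix.of_apply,
      smul_eq_mul]
    rw [mul_one, mul_one, mul_one, show α + β * t = c ^ 2 by linarith]
    field_simp
    ring
  have hleft := mul_eq_one_comm.1 hright
  have key : S * (Sᵀ * S) = S * (α • 1 + β • J) := by
    rw [← Matrix.mul_assoc, hSS, Matrix.add_mul, Matrix.mul_add, Matrix.smul_mul, Matrix.smul_mul,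
      Matrix.mul_smul, Matrix.mul_smul, hSJ, hJS, Matrix.one_mul, Matrix.mul_one]
  have hfin : Sᵀ * S = α • 1 + β • J := by
    rw [← Matrix.one_mul (Sᵀ * S), ← hleft, Matrix.mul_assoc, key, ← Matrix.mul_assoc, hleft,
      Matrix.one_mul]
  rw [hfin]
  refine ⟨fun i j => by simp [hJ], fun i j k l hij hkl => by simp [hJ, hij, hkl]⟩

lemma CompletelySymmetric.smul_one_sub_smul {ι : Type*} [DecidableEq ι] {M : Matrix ι ι ℝ}
    (hM : CompletelySymmetric M) (a b : ℝ) : CompletelySymmetric (a • 1 - b • M) :=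
  ⟨fun i j => by simp [hM.1 i j], fun i j k l h h' => by simp [h, h', hM.2 i j k l h h']⟩

/-- The bound for the trace is attained when the off-diagonal entries of `S` are the two integers
next to `n / (t - 1)`. -/
lemma trace_smul_one_sub_smul_mul_transpose {t n l : ℕ} (ht : 2 ≤ t)
    (hnl : (2 * n : ℝ) = (2 * l + 1) * (t - 1)) {S : Matrix (Fin t) (Fin t) ℝ}
    (hrow : S *ᵥ 1 = fun _ => (n : ℝ)) (hdiag : ∀ a, S a a = 0)
    (hoff : ∀ a b, a ≠ b → S a b = l + 1 ∨ S a b = l) :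
    ((n : ℝ) • 1 - (n : ℝ)⁻¹ • (S * Sᵀ)).trace =
      n * t - t * n / (t - 1) - t * (t - 1) / (4 * n) := by
  have ht' : (2 : ℝ) ≤ t := by exact_mod_cast ht
  have htpos : (0 : ℝ) < (t : ℝ) - 1 := by linarith
  have hn : (0 : ℝ) < n := by nlinarith [mul_pos (by positivity : (0 : ℝ) < 2 * l + 1) htpos]
  have h1 : ∀ a b, S a b * S a b = (2 * l + 1) * S a b - if a = b then 0 else (l * (l + 1) : ℝ) := by
    intro a b
    split_ifs with h
    · rw [h, hdiag]; ring
    · obtain h' | h' := hoff a b h <;> rw [h'] <;> ring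
  have h2 : ∀ a, ∑ b, S a b = n := fun a => by
    simpa [Matrix.mulVec, dotProduct] using congrFun hrow a
  have h3 : (S * Sᵀ).trace = (2 * l + 1) * (t * n) - t * (t - 1) * (l * (l + 1)) := by
    simp only [Matrix.trace, Matrix.diag_apply, Matrix.mul_apply, Matrix.transpose_apply, h1,
      Finset.sum_sub_distrib]
    rw [sum_sum_ite_eq_zero_else]
    simp only [← Finset.mul_sum, h2]
    simp
  rw [Matrix.trace_sub, Matrix.trace_smul, Matrix.trace_smul, Matrix.trace_one, Fintype.card_fin, h3]
  set u : ℝ := (t : ℝ) - 1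
  have hl : (2 * l + 1 : ℝ) = 2 * n / u := by field_simp; linarith
  have hl2 : (l * (l + 1) : ℝ) = ((2 * n / u) ^ 2 - 1) / 4 := by rw [← hl]; ring
  rw [hl, hl2, smul_eq_mul, smul_eq_mul]
  field_simp
  ring

/-! ### Matrices of a design -/

section Design

variable {t n : ℕ} (d : Design t n)

/-- The number of times subject `j` receives treatment `a`. -/
def replications (j : Fin n) (a : Fin t) : ℕ := (Finset.univ.filter fun i => d i j = a).card

/-- The number of appearances of treatment `a` preceded by treatment `b`. -/
def pairCount (a b : Fin t) : ℕ :=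
  (Finset.univ.filter fun p : Fin t × Fin n => d p.1 p.2 = a ∧ d (prevPeriod p.1) p.2 = b).card

lemma sum_replications (j : Fin n) : ∑ a, replications d j a = t := by
  have := Finset.card_eq_sum_card_fiberwise (f := fun i => d i j) (s := Finset.univ)
    (t := Finset.univ) fun _ _ => Finset.mem_coe.2 (Finset.mem_univ _)
  rw [Finset.card_univ, Fintype.card_fin] at this
  exact this.symm

lemma replications_eq_sum (j : Fin n) (a : Fin t) :
    (replications d j a : ℝ) = ∑ i, if d i j = a then 1 else 0 := by
  simp [replications]

lemma replications_eq_sum_prevPeriod (j : Fin n) (a : Fin t) :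
    (replications d j a : ℝ) = ∑ i, if d (prevPeriod i) j = a then 1 else 0 := by
  rw [replications_eq_sum]
  exact (Equiv.sum_comp (finRotate t).symm fun i => if d i j = a then (1 : ℝ) else 0).symm

lemma transpose_T_mul_T :
    (T d)ᵀ * T d = Matrix.diagonal fun a => ∑ j, (replications d j a : ℝ) := by
  ext a b
  simp only [Matrix.mul_apply, Matrix.transpose_apply, T, Matrix.of_apply, Matrix.diagonal_apply,
    replications_eq_sum]
  split_ifs with h
  · subst h
    rw [Fintype.sum_prod_type_right]
    simp only [ite_mul, one_mul, zero_mul, ← ite_and, and_self]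
  · refine Finset.sum_eq_zero fun p _ => ?_
    split_ifs with h1 h2
    · exact absurd (h1.symm.trans h2) h
    all_goals simp

lemma transpose_F_mul_F :
    (F d)ᵀ * F d = Matrix.diagonal fun a => ∑ j, (replications d j a : ℝ) := by
  ext a b
  simp only [Matrix.mul_apply, Matrix.transpose_apply, F, Matrix.of_apply, Matrix.diagonal_apply,
    replications_eq_sum_prevPeriod]
  split_ifs with h
  · subst h
    rw [Fintype.sum_prod_type_right]
    simp only [ite_mul, one_mul, zero_mul, ← ite_and, and_self]
  · refine Finset.sum_eq_zero fun p _ => ?_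
    split_ifs with h1 h2
    · exact absurd (h1.symm.trans h2) h
    all_goals simp

lemma transpose_U_mul_T : (U t n)ᵀ * T d = Matrix.of fun j a => (replications d j a : ℝ) := by
  ext j a
  simp only [Matrix.mul_apply, T, U, Fintype.sum_prod_type, replications_eq_sum,
    Matrix.transpose_apply, Matrix.of_apply, ite_mul, one_mul, zero_mul, Finset.sum_ite_eq',
    Finset.mem_univ, if_true]

lemma transpose_U_mul_F : (U t n)ᵀ * F d = Matrix.of fun j a => (replications d j a : ℝ) := by
  ext j a
  simp only [Matrix.mul_apply, F, U, Fintype.sum_prod_type, replications_eq_sum_prevPeriod,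
    Matrix.transpose_apply, Matrix.of_apply, ite_mul, one_mul, zero_mul, Finset.sum_ite_eq',
    Finset.mem_univ, if_true]

lemma transpose_U_mul_U : (U t n)ᵀ * U t n = (t : ℝ) • 1 := by
  ext j j'
  simp only [Matrix.mul_apply, U, Fintype.sum_prod_type, Matrix.transpose_apply, Matrix.of_apply,
    ite_mul, one_mul, zero_mul, Finset.sum_ite_eq', Finset.mem_univ, if_true, Matrix.smul_apply,
    Matrix.one_apply]
  split_ifs <;> simp

lemma S_eq_pairCount : S d = Matrix.of fun a b => (pairCount d a b : ℝ) := by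
  ext a b
  simp only [S, pairCount, Matrix.mul_apply, T, F, Matrix.transpose_apply, Matrix.of_apply,
    ite_mul, one_mul, zero_mul, ← ite_and]
  simp

lemma transpose_F_mul_T : (F d)ᵀ * T d = (S d)ᵀ := by
  rw [S, Matrix.transpose_mul, Matrix.transpose_transpose]

lemma pairCount_self {d : Design t n} (hd : d ∈ Lam t n) (a : Fin t) : pairCount d a a = 0 := by
  rw [pairCount, Finset.card_eq_zero, Finset.filter_eq_empty_iff]
  rintro p - ⟨h1, h2⟩
  exact hd p.1 p.2 (h2.trans h1.symm)

lemma S_self {d : Design t n} (hd : d ∈ Lam t n) (a : Fin t) : S d a a = 0 := by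
  rw [S_eq_pairCount, Matrix.of_apply, pairCount_self hd, Nat.cast_zero]

lemma T_mulVec_one : T d *ᵥ 1 = 1 := by
  ext p
  simp [Matrix.mulVec, dotProduct, T]

lemma F_mulVec_one : F d *ᵥ 1 = 1 := by
  ext p
  simp [Matrix.mulVec, dotProduct, F]

lemma U_mulVec_one : U t n *ᵥ 1 = 1 := by
  ext p
  simp [Matrix.mulVec, dotProduct, U]

variable {d}

lemma UniformOnSubjects.replications_eq_one (h : UniformOnSubjects d) (j : Fin n) (a : Fin t) :
    replications d j a = 1 := by
  obtain ⟨i, hi, hu⟩ := h j a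
  rw [replications, Finset.card_eq_one]
  refine ⟨i, Finset.eq_singleton_iff_unique_mem.2 ⟨by simpa using hi, fun k hk => hu k ?_⟩⟩
  simpa using hk

lemma UniformOnPeriods.exists_transpose_P_mul (h : UniformOnPeriods d) :
    ∃ c : ℝ, (P t n)ᵀ * T d = Matrix.of (fun _ _ => c) ∧ (P t n)ᵀ * F d = Matrix.of fun _ _ => c := by
  obtain ⟨c, hc⟩ := h
  refine ⟨c, ?_, ?_⟩
  · ext i a
    simp only [Matrix.mul_apply, T, P, Fintype.sum_prod_type_right, Matrix.transpose_apply,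
      Matrix.of_apply, ite_mul, one_mul, zero_mul, Finset.sum_ite_eq', Finset.mem_univ, if_true,
      ← hc i a]
    simp
  · ext i a
    simp only [Matrix.mul_apply, F, P, Fintype.sum_prod_type_right, Matrix.transpose_apply,
      Matrix.of_apply, ite_mul, one_mul, zero_mul, Finset.sum_ite_eq', Finset.mem_univ, if_true,
      ← hc (prevPeriod i) a]
    simp

end Design

/-! ### Universal optimality -/

section Residual

variable {o u ι : Type*} [Fintype o] [Fintype ι]

/-- The condition `hS` makes `T - F * (c⁻¹ • Sᵀ)` orthogonal to each nuisance matrix `U` having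
constant cross products with `T` and `F`. -/
lemma transpose_mul_residual_eq_zero (U : Matrix o u ℝ) (F T : Matrix o ι ℝ) {c κ : ℝ} (hc : c ≠ 0)
    {S : Matrix ι ι ℝ} (hS : S *ᵥ 1 = fun _ => c) (hUT : Uᵀ * T = Matrix.of fun _ _ => κ)
    (hUF : Uᵀ * F = Matrix.of fun _ _ => κ) : Uᵀ * (T - F * (c⁻¹ • Sᵀ)) = 0 := by
  rw [Matrix.mul_sub, ← Matrix.mul_assoc, hUT, hUF]
  ext j a
  have h : ∑ b, S a b = c := by simpa [Matrix.mulVec, dotProduct] using congrFun hS a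
  simp only [Matrix.sub_apply, Matrix.mul_apply, Matrix.of_apply, Matrix.smul_apply,
    Matrix.transpose_apply, smul_eq_mul, ← Finset.mul_sum, h, Matrix.zero_apply]
  rw [inv_mul_cancel₀ hc, mul_one, sub_self]

lemma transpose_mul_residual_self_eq_zero [DecidableEq ι] (F T : Matrix o ι ℝ) {c : ℝ} (hc : c ≠ 0)
    (hFF : Fᵀ * F = c • 1) : Fᵀ * (T - F * (c⁻¹ • (Tᵀ * F)ᵀ)) = 0 := by
  rw [Matrix.mul_sub, ← Matrix.mul_assoc, hFF, Matrix.smul_mul, Matrix.one_mul,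
    smul_inv_smul₀ hc, Matrix.transpose_mul, Matrix.transpose_transpose, sub_self]

lemma transpose_mul_residual [DecidableEq ι] (F T : Matrix o ι ℝ) {c : ℝ} (hTT : Tᵀ * T = c • 1) :
    Tᵀ * (T - F * (c⁻¹ • (Tᵀ * F)ᵀ)) = c • 1 - c⁻¹ • (Tᵀ * F * (Tᵀ * F)ᵀ) := by
  rw [Matrix.mul_sub, hTT, ← Matrix.mul_assoc, Matrix.mul_smul]

end Residual

section Models

variable {t n : ℕ}

lemma infoDirectFull_mem_infoCone (d : Design t n) : infoDirectFull d ∈ InfoCone t :=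
  transpose_mul_omegaPerp_mul_mem_infoCone _ _ (Sum.elim 0 (Sum.elim 1 0)) (by
    rw [Matrix.fromCols_mulVec_sumElim, Matrix.fromCols_mulVec_sumElim, T_mulVec_one, U_mulVec_one]
    simp)

lemma infoCarryFull_mem_infoCone (d : Design t n) : infoCarryFull d ∈ InfoCone t :=
  transpose_mul_omegaPerp_mul_mem_infoCone _ _ (Sum.elim 0 (Sum.elim 1 0)) (by
    rw [Matrix.fromCols_mulVec_sumElim, Matrix.fromCols_mulVec_sumElim, F_mulVec_one, U_mulVec_one]
    simp)

lemma infoDirectNoPeriod_mem_infoCone (d : Design t n) : infoDirectNoPeriod d ∈ InfoCone t :=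
  transpose_mul_omegaPerp_mul_mem_infoCone _ _ (Sum.elim 1 0) (by
    rw [Matrix.fromCols_mulVec_sumElim, T_mulVec_one, U_mulVec_one]
    simp)

lemma infoCarryNoPeriod_mem_infoCone (d : Design t n) : infoCarryNoPeriod d ∈ InfoCone t :=
  transpose_mul_omegaPerp_mul_mem_infoCone _ _ (Sum.elim 1 0) (by
    rw [Matrix.fromCols_mulVec_sumElim, F_mulVec_one, U_mulVec_one]
    simp)

variable {o p u ι : Type*} [Fintype o] [DecidableEq o] [Fintype p] [DecidableEq p] [Fintype u]
  [DecidableEq u] [Fintype ι] [DecidableEq ι]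

lemma trace_omegaPerp_fromCols_le (U : Matrix o u ℝ) (F T : Matrix o ι ℝ) (X : Matrix ι ι ℝ)
    (Y : Matrix u ι ℝ) :
    (Tᵀ * omegaPerp (Matrix.fromCols U F) * T).trace ≤
      ((T - F * X - U * Y)ᵀ * (T - F * X - U * Y)).trace := by
  refine (trace_transpose_mul_omegaPerp_mul_le _ T (Matrix.fromRows Y X)).trans_eq ?_
  rw [Matrix.fromCols_mul_fromRows, add_comm, sub_add_eq_sub_sub]

lemma trace_omegaPerp_fromCols_fromCols_le (P : Matrix o p ℝ) (U : Matrix o u ℝ)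
    (F T : Matrix o ι ℝ) (X : Matrix ι ι ℝ) (Y : Matrix u ι ℝ) :
    (Tᵀ * omegaPerp (Matrix.fromCols P (Matrix.fromCols U F)) * T).trace ≤
      ((T - F * X - U * Y)ᵀ * (T - F * X - U * Y)).trace := by
  refine (trace_transpose_mul_omegaPerp_mul_le _ T
    (Matrix.fromRows 0 (Matrix.fromRows Y X))).trans_eq ?_
  rw [Matrix.fromCols_mul_fromRows, Matrix.fromCols_mul_fromRows, Matrix.mul_zero, zero_add,
    add_comm, sub_add_eq_sub_sub]

lemma transpose_mul_omegaPerp_fromCols (U : Matrix o u ℝ) (F T : Matrix o ι ℝ) {c κ : ℝ}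
    (hc : c ≠ 0) (hTT : Tᵀ * T = c • 1) (hFF : Fᵀ * F = c • 1)
    (hS : (Tᵀ * F) *ᵥ 1 = fun _ => c) (hUT : Uᵀ * T = Matrix.of fun _ _ => κ)
    (hUF : Uᵀ * F = Matrix.of fun _ _ => κ) :
    Tᵀ * omegaPerp (Matrix.fromCols U F) * T = c • 1 - c⁻¹ • (Tᵀ * F * (Tᵀ * F)ᵀ) := by
  rw [← transpose_mul_residual F T hTT]
  refine transpose_mul_omegaPerp_mul_eq _ T _ (Matrix.fromRows 0 (c⁻¹ • (Tᵀ * F)ᵀ)) ?_ ?_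
  · rw [Matrix.fromCols_mul_fromRows, Matrix.mul_zero, zero_add, sub_add_cancel]
  · rw [Matrix.transpose_fromCols, Matrix.fromRows_mul,
      transpose_mul_residual_eq_zero U F T hc hS hUT hUF,
      transpose_mul_residual_self_eq_zero F T hc hFF, Matrix.fromRows_zero]

/-- Nuisance effects orthogonal to the residual, here those of `P`, do not change the information
matrix. -/
lemma transpose_mul_omegaPerp_fromCols_fromCols (P : Matrix o p ℝ) (U : Matrix o u ℝ)
    (F T : Matrix o ι ℝ) {c κ κ' : ℝ} (hc : c ≠ 0) (hTT : Tᵀ * T = c • 1) (hFF : Fᵀ * F = c • 1)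
    (hS : (Tᵀ * F) *ᵥ 1 = fun _ => c) (hUT : Uᵀ * T = Matrix.of fun _ _ => κ)
    (hUF : Uᵀ * F = Matrix.of fun _ _ => κ) (hPT : Pᵀ * T = Matrix.of fun _ _ => κ')
    (hPF : Pᵀ * F = Matrix.of fun _ _ => κ') :
    Tᵀ * omegaPerp (Matrix.fromCols P (Matrix.fromCols U F)) * T =
      c • 1 - c⁻¹ • (Tᵀ * F * (Tᵀ * F)ᵀ) := by
  rw [← transpose_mul_residual F T hTT]
  refine transpose_mul_omegaPerp_mul_eq _ T _
    (Matrix.fromRows 0 (Matrix.fromRows 0 (c⁻¹ • (Tᵀ * F)ᵀ))) ?_ ?_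
  · rw [Matrix.fromCols_mul_fromRows, Matrix.fromCols_mul_fromRows, Matrix.mul_zero,
      Matrix.mul_zero, zero_add, zero_add, sub_add_cancel]
  · rw [Matrix.transpose_fromCols, Matrix.transpose_fromCols, Matrix.fromRows_mul,
      Matrix.fromRows_mul, transpose_mul_residual_eq_zero P F T hc hS hPT hPF,
      transpose_mul_residual_eq_zero U F T hc hS hUT hUF,
      transpose_mul_residual_self_eq_zero F T hc hFF, Matrix.fromRows_zero, Matrix.fromRows_zero]

end Models

lemma universallyOptimal_of_trace_le {t n : ℕ} {info : Design t n → Matrix (Fin t) (Fin t) ℝ}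
    {dstar : Design t n} {𝒟 : Set (Design t n)} (hd : dstar ∈ 𝒟)
    (hmem : ∀ d, info d ∈ InfoCone t) {M : Matrix (Fin t) (Fin t) ℝ} (hM : info dstar = M)
    (hsym : CompletelySymmetric M) (hle : ∀ d ∈ 𝒟, (info d).trace ≤ M.trace) :
    UniversallyOptimal info 𝒟 dstar := by
  subst hM
  exact ⟨hd, fun Φ hΦ d hd' => hΦ.le_of_trace_le (hmem dstar) (hmem d) hsym (hle d hd')⟩

end RepeatedMeasurements

open RepeatedMeasurements in
theorem mainTheorem1 (t n : ℕ) (ht : 5 ≤ t) (htodd : Odd t) (hn : t * (t - 1) / 2 ≤ n)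
    (hmul : ∃ m : ℕ, Odd m ∧ n = m * ((t - 1) / 2)) :
    (∀ dstar ∈ RepeatedMeasurements.Lam t n,
      RepeatedMeasurements.IsCWBD dstar → RepeatedMeasurements.Uniform dstar →
        RepeatedMeasurements.UniversallyOptimal RepeatedMeasurements.infoDirectFull
          (RepeatedMeasurements.Lam t n) dstar ∧
        RepeatedMeasurements.UniversallyOptimal RepeatedMeasurements.infoCarryFull
          (RepeatedMeasurements.Lam t n) dstar) ∧
    (∀ dstar ∈ RepeatedMeasurements.Lam t n,
      RepeatedMeasurements.IsCWBD dstar → RepeatedMeasurements.UniformOnSubjects dstar →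
        RepeatedMeasurements.UniversallyOptimal RepeatedMeasurements.infoDirectNoPeriod
          (RepeatedMeasurements.Lam t n) dstar ∧
        RepeatedMeasurements.UniversallyOptimal RepeatedMeasurements.infoCarryNoPeriod
          (RepeatedMeasurements.Lam t n) dstar) := by
  obtain ⟨m, hm, hnm⟩ := hmul
  have hnm' : (2 * n : ℝ) = m * (t - 1) := by
    obtain ⟨r, hr⟩ := htodd
    rw [hr, Nat.add_sub_cancel, Nat.mul_div_cancel_left _ (by norm_num)] at hnm
    rw [hnm, hr]
    push_cast
    ring
  have hn' : (t * (t - 1) : ℝ) ≤ 2 * n := by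
    have h1 : t * (t - 1) ≤ 2 * n := by
      have := Nat.div_mul_cancel (Nat.even_mul_pred_self t).two_dvd
      omega
    have h2 : ((t * (t - 1) : ℕ) : ℝ) ≤ (2 * n : ℕ) := by exact_mod_cast h1
    rwa [Nat.cast_mul, Nat.cast_pred (by omega), Nat.cast_mul] at h2
  obtain ⟨l, rfl⟩ := id hm
  have ht' : (5 : ℝ) ≤ t := by exact_mod_cast ht
  have htpos : (0 : ℝ) < (t : ℝ) - 1 := by linarith
  have hnpos : (0 : ℝ) < n := by nlinarith
  have hl : (2 * n : ℝ) = (2 * l + 1) * (t - 1) := by rw [hnm']; push_cast; ring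
  have hl0 : (0 : ℝ) < l := by
    by_contra h
    have : (l : ℝ) ≤ 0 := not_lt.1 h
    nlinarith
  have hceil : (⌈(n : ℝ) / ((t : ℝ) - 1)⌉ : ℝ) = l + 1 := by
    have h1 : (n : ℝ) / ((t : ℝ) - 1) = l + 1 / 2 := by
      rw [div_eq_iff htpos.ne']
      linarith
    have h2 : ⌈(n : ℝ) / ((t : ℝ) - 1)⌉ = (l : ℤ) + 1 := by
      rw [h1, Int.ceil_eq_iff]
      push_cast
      constructor <;> linarith
    rw [h2]
    push_cast
    rfl
  have hbound (d : Design t n) (hd : d ∈ Lam t n) :=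
    exists_trace_le ht hm hnm' hn' (T d) (F d) (U t n) (replications d) (pairCount d)
      (transpose_T_mul_T d) (transpose_F_mul_F d) (transpose_U_mul_T d) (transpose_U_mul_F d)
      transpose_U_mul_U (S_eq_pairCount d) (sum_replications d) (pairCount_self hd)
  have hbound' (d : Design t n) (hd : d ∈ Lam t n) :=
    exists_trace_le ht hm hnm' hn' (F d) (T d) (U t n) (replications d)
      (fun a b => pairCount d b a) (transpose_F_mul_F d) (transpose_T_mul_T d)
      (transpose_U_mul_F d) (transpose_U_mul_T d) transpose_U_mul_U
      (by rw [transpose_F_mul_T, S_eq_pairCount]; rfl) (sum_replications d) (pairCount_self hd)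
  have hoff {d : Design t n} (h : IsCWBD d) (a b : Fin t) (hab : a ≠ b) :
      S d a b = l + 1 ∨ S d a b = l := by
    have := h.pairs a b hab
    rwa [hceil, add_sub_cancel_right] at this
  have hCS {d : Design t n} (hd : d ∈ Lam t n) (h : IsCWBD d) :
      CompletelySymmetric ((S d)ᵀ * (S d)ᵀᵀ) := by
    rw [Matrix.transpose_transpose]
    refine h.symmetric.transpose_mul_self (by omega) hnpos h.row_sums h.col_sums (S_self hd) ?_
    intro a b hab
    obtain h' | h' := hoff h a b hab <;> rw [h'] <;> positivity
  have htr {d : Design t n} (hd : d ∈ Lam t n) (h : IsCWBD d) :=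
    trace_smul_one_sub_smul_mul_transpose (by omega) hl h.row_sums (S_self hd) (hoff h)
  have htr' {d : Design t n} (hd : d ∈ Lam t n) (h : IsCWBD d) :=
    trace_smul_one_sub_smul_mul_transpose (S := (S d)ᵀ) (by omega) hl h.col_sums (S_self hd)
      fun a b hab => hoff h b a hab.symm
  have hdiag {d : Design t n} (h : UniformOnSubjects d) :
      (Matrix.diagonal fun a => ∑ j, (replications d j a : ℝ)) = (n : ℝ) • 1 := by
    simp [h.replications_eq_one, Matrix.smul_one_eq_diagonal]
  have hone {d : Design t n} (h : UniformOnSubjects d) :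
      (Matrix.of fun j a => (replications d j a : ℝ)) = Matrix.of fun _ _ => (1 : ℝ) := by
    simp [h.replications_eq_one]
  constructor
  · rintro d hd hC ⟨hP, hU⟩
    obtain ⟨c, hPT, hPF⟩ := hP.exists_transpose_P_mul
    have hTT := (transpose_T_mul_T d).trans (hdiag hU)
    have hFF := (transpose_F_mul_F d).trans (hdiag hU)
    have hUT := (transpose_U_mul_T d).trans (hone hU)
    have hUF := (transpose_U_mul_F d).trans (hone hU)
    constructor
    · refine universallyOptimal_of_trace_le hd infoDirectFull_mem_infoCone
        (transpose_mul_omegaPerp_fromCols_fromCols _ _ _ _ hnpos.ne' hTT hFF hC.row_sums hUT hUF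
          hPT hPF) (hC.symmetric.smul_one_sub_smul _ _) fun d' hd' => ?_
      obtain ⟨X, Y, hXY⟩ := hbound d' hd'
      exact ((trace_omegaPerp_fromCols_fromCols_le _ _ _ _ X Y).trans hXY).trans_eq (htr hd hC).symm
    · have hS : ((F d)ᵀ * T d) *ᵥ 1 = fun _ => (n : ℝ) := by
        rw [transpose_F_mul_T]
        exact hC.col_sums
      refine universallyOptimal_of_trace_le hd infoCarryFull_mem_infoCone
        (transpose_mul_omegaPerp_fromCols_fromCols _ _ _ _ hnpos.ne' hFF hTT hS hUF hUT
          hPF hPT) ?_ fun d' hd' => ?_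
      · rw [transpose_F_mul_T]
        exact (hCS hd hC).smul_one_sub_smul _ _
      · obtain ⟨X, Y, hXY⟩ := hbound' d' hd'
        rw [transpose_F_mul_T, htr' hd hC]
        exact (trace_omegaPerp_fromCols_fromCols_le _ _ _ _ X Y).trans hXY
  · intro d hd hC hU
    have hTT := (transpose_T_mul_T d).trans (hdiag hU)
    have hFF := (transpose_F_mul_F d).trans (hdiag hU)
    have hUT := (transpose_U_mul_T d).trans (hone hU)
    have hUF := (transpose_U_mul_F d).trans (hone hU)
    constructor
    · refine universallyOptimal_of_trace_le hd infoDirectNoPeriod_mem_infoCone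
        (transpose_mul_omegaPerp_fromCols _ _ _ hnpos.ne' hTT hFF hC.row_sums hUT hUF)
        (hC.symmetric.smul_one_sub_smul _ _) fun d' hd' => ?_
      obtain ⟨X, Y, hXY⟩ := hbound d' hd'
      exact ((trace_omegaPerp_fromCols_le _ _ _ X Y).trans hXY).trans_eq (htr hd hC).symm
    · have hS : ((F d)ᵀ * T d) *ᵥ 1 = fun _ => (n : ℝ) := by
        rw [transpose_F_mul_T]
        exact hC.col_sums
      refine universallyOptimal_of_trace_le hd infoCarryNoPeriod_mem_infoCone
        (transpose_mul_omegaPerp_fromCols _ _ _ hnpos.ne' hFF hTT hS hUF hUT) ?_ fun d' hd' => ?_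
      · rw [transpose_F_mul_T]
        exact (hCS hd hC).smul_one_sub_smul _ _
      · obtain ⟨X, Y, hXY⟩ := hbound' d' hd'
        rw [transpose_F_mul_T, htr' hd hC]
        exact (trace_omegaPerp_fromCols_le _ _ _ X Y).trans hXY
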